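/- Let $G_v$ denote the link of a vertex $v$ in a finite simple graph $G$, i.e. the subgraph of $G$ induced by the neighbours of $v$. For integers $a>b\ge 0$, $G$ is called $(a,b)$-regular if $G$ is $a$-regular and every $G_v$ is $b$-regular. A graph $H$ has edge expansion at least $\delta$ if $|E_H(U,V(H)\setminus U)|\ge\delta\min(|U|,|V(H)\setminus U|)$ for every $U\subseteq V(H)$. Let $\lambda_2(G)$ be the second largest eigenvalue (with multiplicity) of the adjacency matrix of $G$. There is a function $\epsilon(a,b,\delta)$, defined for integers $a>b\ge 0$ and real $\delta>0$, with the following properties. (1) $\epsilon(a,b,\delta)>0$ for all $a>b\ge0$ and $\delta>0$, and for every $(a,b)$-regular graph $G$ on $n$ vertices all of whose links have edge expansion at least $\delta$ (where, if $a=b+2$, we assume in addition that $G$ is connected) $$\lambda_2(G)\ \ge\ \left(b+2\sqrt{a-b-1}\right)\left(1+\epsilon(a,b,\delta)\right)-o_n(1),$$ where $o_n(1)$ is a function of $n$ that tends to $0$ as $n\to\infty$ and depends only on $a,b,\delta$. (2) If $b\ge2$ and $a\ge b+3$, then $\epsilon$ is given by $$1+\epsilon(a,b,\delta)=\left(1+\frac{r}{c^2}\right)^{\beta^2}\left(1-\frac{r}{bc^2}\right)^{\beta(1-2\beta)},$$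 where $c=\sqrt{a-b-1}$, $\beta=\frac{c}{b+2c}$ and $r=\min\left(\delta\cdot\min(b+1,a-b-1),\ \frac{b(c^3-c^2)}{b+c}\right)$. (3) If $a\ge b^2+5b+5$, then $\epsilon(a,b,\delta)$ is strictly increasing in $\delta\in(0,b]$ (a $b$-regular graph on at least two vertices has edge expansion at most $b$, so this range contains all values of $\delta$ that can occur). (4) For all $a>b\ge0$ there is $\delta_0=\delta_0(a,b)>0$ such that $\epsilon(a,b,\delta)$ is strictly increasing in $\delta\in(0,\delta_0)$. -/

import Mathlib

namespace LocalGlobal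

open Finset

/-- The link of `v` in `G`: the subgraph of `G` induced by the neighbours of `v`. -/
abbrev link {V : Type*} (G : SimpleGraph V) (v : V) : SimpleGraph (G.neighborSet v) :=
  G.induce (G.neighborSet v)

open Classical in
/-- `G` is `(a, b)`-regular: it is `a`-regular and all its links are `b`-regular. -/
def IsABRegular {V : Type*} [Fintype V] (G : SimpleGraph V) (a b : ℕ) : Prop :=
  G.IsRegularOfDegree a ∧ ∀ v : V, (link G v).IsRegularOfDegree b

open Classical in
/-- `|E(U, V \ U)| ≥ δ * min(|U|, |V \ U|)` for every set `U` of vertices. In `interedges U Uᶜ`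
every edge between `U` and its complement occurs exactly once, as a pair in `U × Uᶜ`. -/
def IsEdgeExpander {V : Type*} [Fintype V] (G : SimpleGraph V) (δ : ℝ) : Prop :=
  ∀ U : Finset V, δ * min (#U : ℝ) (#Uᶜ : ℝ) ≤ (#(G.interedges U Uᶜ) : ℝ)

open Classical in
/-- All links of `G` have edge expansion at least `δ`. -/
def LinksExpand {V : Type*} [Fintype V] (G : SimpleGraph V) (δ : ℝ) : Prop :=
  ∀ v : V, IsEdgeExpander (link G v) δ

open Classical in
/-- The second largest eigenvalue, with multiplicity, of the adjacency matrix
(`eigenvalues₀` lists the eigenvalues in decreasing order, indexed from `0`);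
the value is `0` by convention if `G` has fewer than two vertices. -/
noncomputable def secondEigenvalue {V : Type*} [Fintype V] (G : SimpleGraph V) : ℝ :=
  if h : 1 < Fintype.card V then (G.isHermitian_adjMatrix ℝ).eigenvalues₀ ⟨1, h⟩ else 0

/-- `c = √(a - b - 1)`. -/
noncomputable def cParam (a b : ℕ) : ℝ := √((a : ℝ) - b - 1)

/-- `r = min (δ * min (b + 1, a - b - 1), b * (c ^ 3 - c ^ 2) / (b + c))`. -/
noncomputable def rParam (a b : ℕ) (δ : ℝ) : ℝ :=
  min (δ * min ((b : ℝ) + 1) ((a : ℝ) - b - 1))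
    (b * (cParam a b ^ 3 - cParam a b ^ 2) / (b + cParam a b))

/-- `Δ = β ^ 2 * log (1 + r / c ^ 2) + β * (1 - 2 * β) * log (1 - r / (b * c ^ 2))`
with `β = c / (b + 2 * c)`. -/
noncomputable def gain (a b : ℕ) (δ : ℝ) : ℝ :=
  let c := cParam a b
  let r := rParam a b δ
  let β := c / (b + 2 * c)
  β ^ 2 * Real.log (1 + r / c ^ 2) + β * (1 - 2 * β) * Real.log (1 - r / (b * c ^ 2))

end LocalGlobal

universe u

/-!
If `G` has many vertices, it contains two vertices at a large distance. Around each of them we put a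
nonnegative function `f` of bounded support with `l • f ≤ A f`, where `A` is the adjacency matrix
and `l` is slightly below the claimed bound. The two supports neither meet nor touch, so `A` has two
eigenvalues that are at least `l`.

Let `f` be radial at first, with value `Y i` at distance `i` from the root. A vertex `x` has at
least `b + 1` neighbours that are not further from the root than `x` itself: one that is closer, and
the common neighbours of `x` and this one. In the extreme case the condition on `f` is the
recurrence of a tree, whose growth rate is `b + 2 * c`. To improve on this, `f` gets a bonus, scaled
by `1 / Λ`, at vertices with several lower neighbours. By the expansion of the link of `x` there are
many edges between the upper neighbours of `x` and its other neighbours, and each of them gives an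
upper neighbour an additional lower neighbour. In the recurrence this moves `s = r / Λ` from the
outermost coefficient to the middle one, and the growth rate becomes `b + s + 2 * √(c ^ 2 - s)`.
Concavity of the logarithm shows that this is at least `Λ = (b + 2 * c) * exp Δ`.

The remaining cases are degenerate: `b ≤ 1` forces `a = b + 1`, as the links are connected; for
`a = b + 1` the graph is a disjoint union of complete graphs; and for `a = b + 2`, `0 < b` a
connected graph has diameter at most `2`.
-/

namespace LocalGlobal

open Finset Filter Topology
open scoped Matrix

/-! ### The growth rate -/

/-- The logarithmic gain `Δ` of the theorem as a function of `b`, `c` and `r`, with the weights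
`β ^ 2` and `β * (1 - 2 * β)` written out for `β = c / (b + 2 * c)`. -/
noncomputable def gainFun (b c r : ℝ) : ℝ :=
  c / (b + 2 * c) ^ 2 * (c * Real.log (1 + r / c ^ 2) + b * Real.log (1 - r / (b * c ^ 2)))

/-- The cap on the parameter `r`; it is the point where `gainFun b c` attains its maximum. -/
noncomputable def gainCap (b c : ℝ) : ℝ := b * (c ^ 3 - c ^ 2) / (b + c)

/-- The lower bound `Λ` on the second eigenvalue in the generic range. -/
noncomputable def growthRate (b c r : ℝ) : ℝ := (b + 2 * c) * Real.exp (gainFun b c r)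

@[simp]
lemma gainFun_zero (b c : ℝ) : gainFun b c 0 = 0 := by simp [gainFun]

section GrowthRate

variable {b c k r : ℝ}

lemma gainCap_pos (hb : 0 < b) (hc : 1 < c) : 0 < gainCap b c := by
  have : 0 < c := one_pos.trans hc
  have : 0 < c ^ 3 - c ^ 2 := sub_pos.2 (pow_lt_pow_right₀ hc (by norm_num))
  unfold gainCap
  positivity

lemma lt_mul_sq_of_le_gainCap (hb : 0 < b) (hc : 0 < c) (hr : r ≤ gainCap b c) :
    r < b * c ^ 2 := by
  refine hr.trans_lt ?_
  rw [gainCap, div_lt_iff₀ (by positivity)]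
  have : 0 < b * c ^ 2 * (b + 1) := by positivity
  linarith

lemma hasDerivAt_gainFun (hb : 0 < b) (hc : 0 < c) (hr : -c ^ 2 < r) (hr' : r < b * c ^ 2) :
    HasDerivAt (gainFun b c) (c / (b + 2 * c) ^ 2 *
      ((b + c) * (gainCap b c - r) / ((c ^ 2 + r) * (b * c ^ 2 - r)))) r := by
  have hp : c ^ 2 + r ≠ 0 := by linarith
  have hq : b * c ^ 2 - r ≠ 0 := by linarith
  have hP : 1 + r / c ^ 2 ≠ 0 := by
    rw [one_add_div (by positivity)]; exact div_ne_zero hp (by positivity)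
  have hQ : 1 - r / (b * c ^ 2) ≠ 0 := by
    rw [one_sub_div (by positivity)]; exact div_ne_zero hq (by positivity)
  have hlogP := (((hasDerivAt_id r).div_const (c ^ 2)).const_add 1).log hP
  have hlogQ := (((hasDerivAt_id r).div_const (b * c ^ 2)).const_sub 1).log hQ
  refine (((hlogP.const_mul c).add (hlogQ.const_mul b)).const_mul (c / (b + 2 * c) ^ 2)).congr_deriv
    ?_
  have hlog : c * (1 / c ^ 2 / (1 + r / c ^ 2)) + b * (-(1 / (b * c ^ 2)) / (1 - r / (b * c ^ 2)))
      = c / (c ^ 2 + r) - b / (b * c ^ 2 - r) := by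
    rw [one_add_div (by positivity), one_sub_div (by positivity), div_div_div_cancel_right₀
      (by positivity), neg_div, div_div_div_cancel_right₀ (by positivity)]
    ring
  have hcap : (b + c) * gainCap b c = b * (c ^ 3 - c ^ 2) := mul_div_cancel₀ _ (by positivity)
  simp only [id, hlog, div_sub_div _ _ hp hq, mul_sub, hcap]
  ring

lemma strictMonoOn_gainFun (hb : 0 < b) (hc : 0 < c) :
    StrictMonoOn (gainFun b c) (Set.Icc 0 (gainCap b c)) := by
  have hderiv {r : ℝ} (hr : r ∈ Set.Icc 0 (gainCap b c)) :=
    hasDerivAt_gainFun hb hc ((neg_neg_of_pos (by positivity)).trans_le hr.1)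
      (lt_mul_sq_of_le_gainCap hb hc hr.2)
  refine strictMonoOn_of_deriv_pos (convex_Icc _ _)
    (fun r hr => (hderiv hr).continuousAt.continuousWithinAt) fun r hr => ?_
  have hr' := interior_subset hr
  rw [interior_Icc] at hr
  have h0 := hr.1
  have hcap := sub_pos.2 hr.2
  have hq := sub_pos.2 (lt_mul_sq_of_le_gainCap hb hc hr'.2)
  rw [(hderiv hr').deriv]
  positivity

lemma gainFun_pos (hb : 0 < b) (hc : 0 < c) (hr : 0 < r) (hr' : r ≤ gainCap b c) :
    0 < gainFun b c r := by
  simpa using strictMonoOn_gainFun hb hc ⟨le_rfl, hr.le.trans hr'⟩ ⟨hr.le, hr'⟩ hr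

/- Concavity of the logarithm at the points `Q`, `k / c * P`, `c / k * u` with weights `b`, `c`,
`c`. The tilt by `k / c` cancels on the left. -/
lemma weighted_log_le_log_mean {P Q u : ℝ} (hb : 0 ≤ b) (hc : 0 < c) (hk : 0 < k) (hP : 0 < P)
    (hQ : 0 < Q) (hu : 0 < u) :
    b * Real.log Q + c * (Real.log P + Real.log u)
      ≤ (b + 2 * c) * Real.log ((b * Q + k * P + c ^ 2 / k * u) / (b + 2 * c)) := by
  have hL : 0 < b + 2 * c := by positivity
  have hjensen := strictConcaveOn_log_Ioi.concaveOn.le_map_sum (t := univ)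
    (w := ![b / (b + 2 * c), c / (b + 2 * c), c / (b + 2 * c)]) (p := ![Q, k / c * P, c / k * u])
    (fun i _ => by fin_cases i <;> dsimp <;> positivity)
    (by simp only [Fin.sum_univ_three, Matrix.cons_val]; field_simp; ring)
    (fun i _ => by rw [Set.mem_Ioi]; fin_cases i <;> dsimp <;> positivity)
  simp only [Fin.sum_univ_three, smul_eq_mul, Matrix.cons_val] at hjensen
  rw [Real.log_mul (by positivity) hP.ne', Real.log_mul (by positivity) hu.ne',
    Real.log_div hk.ne' hc.ne', Real.log_div hc.ne' hk.ne'] at hjensen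
  calc b * Real.log Q + c * (Real.log P + Real.log u) = (b + 2 * c) * _ := ?_
    _ ≤ _ := mul_le_mul_of_nonneg_left hjensen hL.le
    _ = _ := by congr 2; field_simp
  field_simp
  ring

/- With `u` chosen so that `Λ = b + k + c ^ 2 / k * u`, the vector `(1, u)` is an approximate
eigenvector of a `2 × 2` transfer matrix. -/
lemma growthRate_mul_le {u : ℝ} (hb : 0 < b) (hc : 0 < c) (hk : 0 < k) (hu : 0 < u) (hr : 0 ≤ r)
    (hr' : r < b * c ^ 2) (hΛ : growthRate b c r = b + k + c ^ 2 / k * u) :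
    growthRate b c r * u
      ≤ b * (1 - r / (b * c ^ 2)) + k * (1 + r / c ^ 2) + c ^ 2 / k * u := by
  set P := 1 + r / c ^ 2 with hPdef
  set Q := 1 - r / (b * c ^ 2) with hQdef
  have hP : 0 < P := by positivity
  have hQ : 0 < Q := by rw [hQdef, sub_pos, div_lt_one (by positivity)]; exact hr'
  have hL : 0 < b + 2 * c := by positivity
  set T := b * Q + k * P + c ^ 2 / k * u
  have : 0 < T := by positivity
  have row₁ := weighted_log_le_log_mean hb.le hc hk one_pos one_pos hu
  rw [mul_one, mul_one, ← hΛ, growthRate, mul_div_cancel_left₀ _ hL.ne', Real.log_exp,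
    Real.log_one, mul_zero, zero_add, zero_add] at row₁
  have row₂ := weighted_log_le_log_mean hb.le hc hk hP hQ hu
  have hgain : (b + 2 * c) ^ 2 * gainFun b c r = c * (c * Real.log P + b * Real.log Q) := by
    rw [gainFun, ← hPdef, ← hQdef]
    generalize Real.log P = p, Real.log Q = q
    field_simp
  have hlog : gainFun b c r + Real.log u ≤ Real.log (T / (b + 2 * c)) := by
    refine le_of_mul_le_mul_left ?_ (mul_pos hc hL)
    linarith [mul_le_mul_of_nonneg_left row₁ (add_pos hb hc).le,
      mul_le_mul_of_nonneg_left row₂ hc.le]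
  calc growthRate b c r * u = (b + 2 * c) * Real.exp (gainFun b c r + Real.log u) := by
        rw [growthRate, Real.exp_add, Real.exp_log hu, mul_assoc]
    _ ≤ (b + 2 * c) * (T / (b + 2 * c)) := by
        gcongr
        exact (Real.le_log_iff_exp_le (by positivity)).1 hlog
    _ = T := mul_div_cancel₀ _ hL.ne'

lemma le_growthRate (hb : 0 < b) (hc : 0 < c) (hr : r ∈ Set.Icc 0 (gainCap b c)) :
    b + 2 * c ≤ growthRate b c r := by
  have hgain : 0 ≤ gainFun b c r := by
    simpa using (strictMonoOn_gainFun hb hc).monotoneOn ⟨le_rfl, hr.1.trans hr.2⟩ hr hr.1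
  exact le_mul_of_one_le_right (by positivity) (Real.one_le_exp hgain)

lemma div_growthRate_lt_sq (hb : 0 < b) (hc : 0 < c) (hr : r ∈ Set.Icc 0 (gainCap b c)) :
    r / growthRate b c r < c ^ 2 := by
  have hΛ := le_growthRate hb hc hr
  rw [div_lt_iff₀ (by linarith)]
  calc r < b * c ^ 2 := lt_mul_sq_of_le_gainCap hb hc hr.2
    _ ≤ c ^ 2 * growthRate b c r := by
        rw [mul_comm]; exact mul_le_mul_of_nonneg_left (by linarith) (sq_nonneg c)

/- The right-hand side is the growth rate of the radial recurrence when each sphere loses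
`s = r / Λ` of its outward edges to the inside. -/
lemma growthRate_le_add_two_mul_sqrt (hb : 0 < b) (hc : 0 < c)
    (hr : r ∈ Set.Icc 0 (gainCap b c)) :
    growthRate b c r
      ≤ b + r / growthRate b c r + 2 * √(c ^ 2 - r / growthRate b c r) := by
  have hLΛ := le_growthRate hb hc hr
  have hs := div_growthRate_lt_sq hb hc hr
  have hsΛ : r = r / growthRate b c r * growthRate b c r := by
    rw [div_mul_cancel₀ _ (by linarith)]
  have hmul (u : ℝ) (k : ℝ) (hk : 0 < k) (hu : 0 < u) :=
    growthRate_mul_le hb hc hk hu hr.1 (lt_mul_sq_of_le_gainCap hb hc hr.2)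
  have hs0 : 0 ≤ r / growthRate b c r := div_nonneg hr.1 (by linarith)
  set Λ := growthRate b c r
  set s := r / Λ
  set k := √(c ^ 2 - s)
  have hk : 0 < k := Real.sqrt_pos.2 (by linarith)
  have hk2 : k ^ 2 = c ^ 2 - s := Real.sq_sqrt (by linarith)
  have hkc : k ≤ c := Real.sqrt_le_iff.2 ⟨hc.le, by linarith⟩
  have hbk : 0 < Λ - b - k := by linarith
  have hrow := hmul (k * (Λ - b - k) / c ^ 2) k hk (by positivity) (by field_simp; ring)
  have hΛ : Λ * (k * (Λ - b - k)) ≤ Λ * (c ^ 2 - (1 - k) * s) := by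
    rw [hsΛ] at hrow
    field_simp at hrow
    linarith
  have : k * (Λ - b - k) ≤ k * (k + s) :=
    (le_of_mul_le_mul_left hΛ (by linarith)).trans_eq (by linear_combination -hk2)
  linarith [le_of_mul_le_mul_left this hk]

end GrowthRate

/-! ### Radial profiles -/

/-- The least antitone majorant of a sequence `y` bounded above; the recurrence of `IsProfile`
survives the passage from `y` to `tailSup y`. -/
noncomputable def tailSup (y : ℕ → ℝ) (i : ℕ) : ℝ := ⨆ j, y (i + j)

/-- The radial profiles of the test functions: antitone sequences supported on `i < R`, constant on
`{0, 1}`, that satisfy `l * Y (i + 1) ≤ Y i + B * Y (i + 1) + K * Y (i + 2)`. -/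
structure IsProfile (l B K : ℝ) (R : ℕ) (Y : ℕ → ℝ) : Prop where
  antitone : Antitone Y
  eq_zero : ∀ i, R ≤ i → Y i = 0
  zero_pos : 0 < Y 0
  zero_eq_one : Y 0 = Y 1
  recurrence : ∀ i, l * Y (i + 1) ≤ Y i + B * Y (i + 1) + K * Y (i + 2)

lemma IsProfile.nonneg {l B K : ℝ} {R : ℕ} {Y : ℕ → ℝ} (hY : IsProfile l B K R Y) (i : ℕ) :
    0 ≤ Y i :=
  (hY.eq_zero _ (le_max_right i R)).ge.trans (hY.antitone (le_max_left i R))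

section TailSup

variable {y : ℕ → ℝ}

lemma bddAbove_tail (hy : BddAbove (Set.range y)) (i : ℕ) :
    BddAbove (Set.range fun j => y (i + j)) :=
  hy.mono (Set.range_comp_subset_range (i + ·) y)

lemma tailSup_eq_max (hy : BddAbove (Set.range y)) (i : ℕ) :
    tailSup y i = max (y i) (tailSup y (i + 1)) := by
  refine le_antisymm (ciSup_le fun j => ?_) (max_le ?_ (ciSup_le fun j => ?_))
  · cases j with
    | zero => exact le_max_left _ _
    | succ j =>
      rw [← add_assoc, add_right_comm]
      exact le_max_of_le_right (le_ciSup (bddAbove_tail hy (i + 1)) j)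
  · exact le_ciSup (bddAbove_tail hy i) 0
  · rw [add_assoc]
    exact le_ciSup (bddAbove_tail hy i) (1 + j)

lemma le_tailSup (hy : BddAbove (Set.range y)) (i : ℕ) : y i ≤ tailSup y i :=
  (tailSup_eq_max hy i).ge.trans' (le_max_left _ _)

lemma antitone_tailSup (hy : BddAbove (Set.range y)) : Antitone (tailSup y) :=
  antitone_nat_of_succ_le fun i => (tailSup_eq_max hy i).ge.trans' (le_max_right _ _)

lemma tailSup_eq_zero {R i : ℕ} (hy : ∀ j, R ≤ j → y j = 0) (hi : R ≤ i) : tailSup y i = 0 := by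
  simp [tailSup, fun j => hy (i + j) (by omega)]

lemma tailSup_recurrence {l B K : ℝ} (hy : BddAbove (Set.range y)) (h0 : ∀ i, 0 ≤ y i)
    (hK : 0 ≤ K) (hl : l ≤ 1 + B + K)
    (hrec : ∀ i, l * y (i + 1) ≤ y i + B * y (i + 1) + K * y (i + 2)) (i : ℕ) :
    l * tailSup y (i + 1)
      ≤ tailSup y i + B * tailSup y (i + 1) + K * tailSup y (i + 2) := by
  have hmax := tailSup_eq_max hy (i + 1)
  rcases le_total (tailSup y (i + 2)) (y (i + 1)) with h | h
  · rw [max_eq_left h] at hmax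
    rw [hmax]
    linarith [hrec i, le_tailSup hy i, mul_le_mul_of_nonneg_left (le_tailSup hy (i + 2)) hK]
  · rw [max_eq_right h] at hmax
    rw [← hmax]
    have hpos := (h0 (i + 1)).trans (le_tailSup hy (i + 1))
    linarith [mul_le_mul_of_nonneg_right hl hpos, antitone_tailSup hy i.le_succ]

end TailSup

/-- The solution `k⁻¹ ^ m * sin (m * π / R)` of the recurrence
`2 * k * cos (π / R) * y (m + 1) = y m + k ^ 2 * y (m + 2)`, cut off at its second zero `m = R`. -/
noncomputable def sinProfile (k : ℝ) (R m : ℕ) : ℝ :=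
  if m ≤ R then k⁻¹ ^ m * Real.sin (m * (Real.pi / R)) else 0

section SinProfile

variable {k : ℝ} {R : ℕ}

lemma sinProfile_eq_zero {m : ℕ} (h : R ≤ m) : sinProfile k R m = 0 := by
  rcases h.eq_or_lt with rfl | h
  · obtain rfl | hR := Nat.eq_zero_or_pos R
    · simp [sinProfile]
    · rw [sinProfile, mul_div_cancel₀ _ (by positivity), Real.sin_pi, mul_zero, ite_self]
  · exact if_neg h.not_ge

lemma sinProfile_nonneg (hk : 0 ≤ k) (m : ℕ) : 0 ≤ sinProfile k R m := by
  unfold sinProfile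
  split_ifs with h
  · refine mul_nonneg (by positivity) (Real.sin_nonneg_of_nonneg_of_le_pi (by positivity) ?_)
    rw [mul_div_left_comm]
    exact mul_le_of_le_one_right Real.pi_nonneg (div_le_one_of_le₀ (mod_cast h) R.cast_nonneg)
  · exact le_rfl

lemma sinProfile_one_pos (hk : 0 < k) (hR : 2 ≤ R) : 0 < sinProfile k R 1 := by
  have hR' : (1 : ℝ) < R := by exact_mod_cast hR
  rw [sinProfile, if_pos (by omega), Nat.cast_one, one_mul]
  exact mul_pos (by positivity) (Real.sin_pos_of_pos_of_lt_pi (by positivity)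
    (div_lt_self Real.pi_pos hR'))

lemma bddAbove_range_sinProfile (k : ℝ) (R : ℕ) : BddAbove (Set.range (sinProfile k R)) := by
  refine ((Set.finite_Iic R).image (sinProfile k R) |>.union (Set.finite_singleton 0)).bddAbove.mono
    (Set.range_subset_iff.2 fun m => ?_)
  rcases le_total m R with h | h
  · exact Or.inl ⟨m, h, rfl⟩
  · exact Or.inr (sinProfile_eq_zero h)

lemma two_mul_cos_mul_sinProfile (hk : k ≠ 0) {m : ℕ} (h : m + 2 ≤ R) :
    2 * k * Real.cos (Real.pi / R) * sinProfile k R (m + 1)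
      = sinProfile k R m + k ^ 2 * sinProfile k R (m + 2) := by
  simp only [sinProfile, if_pos h, if_pos (show m + 1 ≤ R by omega), if_pos (show m ≤ R by omega)]
  set θ := Real.pi / R
  have hsin := Real.two_mul_sin_mul_cos (((m + 1 : ℕ) : ℝ) * θ) θ
  rw [show ((m + 1 : ℕ) : ℝ) * θ - θ = m * θ by push_cast; ring,
    show ((m + 1 : ℕ) : ℝ) * θ + θ = ((m + 2 : ℕ) : ℝ) * θ by push_cast; ring] at hsin
  calc _ = k * k⁻¹ ^ (m + 1) * (2 * Real.sin (((m + 1 : ℕ) : ℝ) * θ) * Real.cos θ) := by ring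
    _ = _ := by
      rw [hsin, pow_add, pow_add]
      field_simp

lemma sinProfile_recurrence {l B : ℝ} (hk : 0 < k) (hl : l ≤ B + 2 * k * Real.cos (Real.pi / R))
    (m : ℕ) : l * sinProfile k R (m + 1)
      ≤ sinProfile k R m + B * sinProfile k R (m + 1) + k ^ 2 * sinProfile k R (m + 2) := by
  have h0 := sinProfile_nonneg (R := R) hk.le
  rcases le_or_gt (m + 2) R with h | h
  · linarith [mul_le_mul_of_nonneg_right hl (h0 (m + 1)), two_mul_cos_mul_sinProfile hk.ne' h]
  · rw [sinProfile_eq_zero (Nat.lt_succ_iff.1 h), mul_zero, mul_zero, add_zero]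
    exact add_nonneg (h0 m) (mul_nonneg (sq_nonneg k) (h0 (m + 2)))

lemma isProfile_tailSup_sinProfile {l B : ℝ} (hR : 2 ≤ R) (hk : 0 < k)
    (hl : l ≤ B + 2 * k * Real.cos (Real.pi / R)) (hl' : l ≤ 1 + B + k ^ 2) :
    IsProfile l B (k ^ 2) R (tailSup (sinProfile k R)) := by
  have hbdd := bddAbove_range_sinProfile k R
  have hpos : 0 < tailSup (sinProfile k R) 1 :=
    (sinProfile_one_pos hk hR).trans_le (le_tailSup hbdd 1)
  have h01 : tailSup (sinProfile k R) 0 = tailSup (sinProfile k R) 1 := by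
    rw [tailSup_eq_max hbdd 0, max_eq_right]
    simpa [sinProfile] using hpos.le
  exact ⟨antitone_tailSup hbdd, fun i => tailSup_eq_zero fun j => sinProfile_eq_zero,
    h01 ▸ hpos, h01, tailSup_recurrence hbdd (sinProfile_nonneg hk.le) (sq_nonneg k) hl'
      (sinProfile_recurrence hk hl)⟩

end SinProfile

/- The limit growth rate `B + 2 * k` is not attained: the support of the profile grows as `l`
approaches it. -/
lemma exists_isProfile {l B k : ℝ} (hk : 0 < k) (hl : l < B + 2 * k) :
    ∃ R Y, IsProfile l B (k ^ 2) R Y := by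
  have hcos : Tendsto (fun R : ℕ => B + 2 * k * Real.cos (Real.pi / R)) atTop
      (𝓝 (B + 2 * k)) := by
    simpa using (((Real.continuous_cos.tendsto 0).comp
      (tendsto_const_div_atTop_nhds_zero_nat Real.pi)).const_mul (2 * k)).const_add B
  obtain ⟨R, hlR, hR⟩ := ((hcos.eventually_const_lt hl).and (eventually_ge_atTop 2)).exists
  exact ⟨R, _, isProfile_tailSup_sinProfile hR hk hlR.le (by linarith [sq_nonneg (k - 1)])⟩

/-! ### Lower bounds for the second eigenvalue -/

section Spectral

variable {n : Type*} [Fintype n] [DecidableEq n] {A : Matrix n n ℝ} (hA : A.IsHermitian) {l : ℝ}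

lemma dotProduct_eq_sum_eigenvectorBasis (x y : n → ℝ) :
    x ⬝ᵥ y = ∑ i, (⇑(hA.eigenvectorBasis i) ⬝ᵥ x) * (⇑(hA.eigenvectorBasis i) ⬝ᵥ y) := by
  have h := hA.eigenvectorBasis.sum_inner_mul_inner (WithLp.toLp 2 x) (WithLp.toLp 2 y)
  simp only [EuclideanSpace.inner_eq_star_dotProduct, star_trivial] at h
  rw [dotProduct_comm x y, ← h]
  exact sum_congr rfl fun i _ => by rw [dotProduct_comm y]

lemma eigenvectorBasis_dotProduct_mulVec (i : n) (x : n → ℝ) :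
    ⇑(hA.eigenvectorBasis i) ⬝ᵥ (A *ᵥ x)
      = hA.eigenvalues i * (⇑(hA.eigenvectorBasis i) ⬝ᵥ x) := by
  have hAT : Aᵀ = A := by rw [← Matrix.conjTranspose_eq_transpose_of_trivial, hA.eq]
  rw [Matrix.dotProduct_mulVec, ← Matrix.mulVec_transpose, hAT, hA.mulVec_eigenvectorBasis,
    smul_dotProduct, smul_eq_mul]

/- Some nonzero `x ∈ W` is orthogonal to the eigenvectors indexed by `s`. -/
lemma exists_le_eigenvalues {W : Submodule ℝ (n → ℝ)} {s : Finset n}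
    (hs : #s < Module.finrank ℝ W) (hW : ∀ x ∈ W, l * (x ⬝ᵥ x) ≤ x ⬝ᵥ (A *ᵥ x)) :
    ∃ i ∉ s, l ≤ hA.eigenvalues i := by
  by_contra! hlt
  set e : n → n → ℝ := fun i => ⇑(hA.eigenvectorBasis i)
  obtain ⟨⟨x, hxW⟩, hx, hx0⟩ := (Submodule.ne_bot_iff _).1 <| LinearMap.ker_ne_bot_of_finrank_lt
    (f := (Matrix.mulVecLin (Matrix.of fun i : s => e i)).domRestrict W) (by simpa using hs)
  have hxs (i : n) (hi : i ∈ s) : e i ⬝ᵥ x = 0 := congrFun (LinearMap.mem_ker.1 hx) ⟨i, hi⟩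
  have hxx : 0 < x ⬝ᵥ x := by
    simpa using Matrix.dotProduct_star_self_pos_iff.2 fun h => hx0 (Subtype.ext h)
  obtain ⟨j, -, hj⟩ : ∃ j ∈ univ, 0 < (e j ⬝ᵥ x) * (e j ⬝ᵥ x) :=
    exists_lt_of_sum_lt (by simpa [dotProduct_eq_sum_eigenvectorBasis hA x x] using hxx)
  have hle := hW x hxW
  rw [dotProduct_eq_sum_eigenvectorBasis hA x x, dotProduct_eq_sum_eigenvectorBasis hA x (A *ᵥ x),
    mul_sum] at hle
  refine hle.not_gt (sum_lt_sum (fun i _ => ?_) ⟨j, mem_univ j, ?_⟩)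
  all_goals rw [eigenvectorBasis_dotProduct_mulVec, mul_left_comm]
  · by_cases hi : i ∈ s
    · rw [hxs i hi]; simp
    · exact mul_le_mul_of_nonneg_right (hlt i hi).le (mul_self_nonneg _)
  · exact mul_lt_mul_of_pos_right (hlt j fun hjs => by simp [hxs j hjs] at hj) hj

lemma le_eigenvalues₀_of_lt_finrank {W : Submodule ℝ (n → ℝ)} {k : Fin (Fintype.card n)}
    (hk : k < Module.finrank ℝ W) (hW : ∀ x ∈ W, l * (x ⬝ᵥ x) ≤ x ⬝ᵥ (A *ᵥ x)) :
    l ≤ hA.eigenvalues₀ k := by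
  let φ : Fin (Fintype.card n) ≃ n := Fintype.equivOfCardEq (Fintype.card_fin _)
  obtain ⟨i, hi, hli⟩ := exists_le_eigenvalues hA (s := (Iio k).map φ.toEmbedding)
    (by simpa using hk) hW
  refine hli.trans (hA.eigenvalues₀_antitone (le_of_not_gt fun h => hi ?_))
  exact mem_map.2 ⟨φ.symm i, mem_Iio.2 h, φ.apply_symm_apply i⟩

lemma le_eigenvalues₀_of_orthogonal {ι : Type*} [Fintype ι] {f : ι → n → ℝ}
    (hf : ∀ i, f i ≠ 0) (hform : ∀ i, l * (f i ⬝ᵥ f i) ≤ f i ⬝ᵥ (A *ᵥ f i))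
    (horth : Pairwise fun i j => f i ⬝ᵥ f j = 0)
    (horthA : Pairwise fun i j => f i ⬝ᵥ (A *ᵥ f j) = 0) {k : Fin (Fintype.card n)}
    (hk : k < Fintype.card ι) : l ≤ hA.eigenvalues₀ k := by
  have hdiag (g : ι → ℝ) (B : ι → n → ℝ) (hB : Pairwise fun i j => f i ⬝ᵥ B j = 0) (i : ι) :
      f i ⬝ᵥ ∑ j, g j • B j = g i * (f i ⬝ᵥ B i) := by
    rw [dotProduct_sum, sum_eq_single i (fun j _ hji => by rw [dotProduct_smul, hB hji.symm,
      smul_zero]) (by simp), dotProduct_smul, smul_eq_mul]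
  have hli : LinearIndependent ℝ f := Fintype.linearIndependent_iff.2 fun g hg i => by
    have := hdiag g f horth i
    rw [hg, dotProduct_zero, zero_eq_mul, dotProduct_self_eq_zero] at this
    exact this.resolve_right (hf i)
  refine le_eigenvalues₀_of_lt_finrank hA (W := Submodule.span ℝ (Set.range f))
    (by rwa [finrank_span_eq_card hli]) fun x hx => ?_
  obtain ⟨g, rfl⟩ := (Submodule.mem_span_range_iff_exists_fun ℝ).1 hx
  rw [Matrix.mulVec_sum]
  simp only [Matrix.mulVec_smul, sum_dotProduct, smul_dotProduct, smul_eq_mul, hdiag g f horth,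
    hdiag g (fun j => A *ᵥ f j) horthA, mul_sum]
  refine sum_le_sum fun i _ => ?_
  linarith [mul_le_mul_of_nonneg_left (hform i) (mul_self_nonneg (g i))]

end Spectral

section SecondEigenvalue

variable {V : Type*} [Fintype V] {G : SimpleGraph V} [DecidableRel G.Adj]

lemma le_secondEigenvalue {l : ℝ} {f g : V → ℝ} (hf : 0 ≤ f) (hg : 0 ≤ g) (hf0 : f ≠ 0)
    (hg0 : g ≠ 0) (hlf : l • f ≤ G.adjMatrix ℝ *ᵥ f) (hlg : l • g ≤ G.adjMatrix ℝ *ᵥ g)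
    (hfg : ∀ x y, f x ≠ 0 → g y ≠ 0 → x ≠ y ∧ ¬ G.Adj x y) : l ≤ secondEigenvalue G := by
  classical
  have hinst : ‹DecidableRel G.Adj› = fun _ _ => Classical.propDecidable _ :=
    Subsingleton.elim _ _
  subst hinst
  obtain ⟨v, hv⟩ := Function.ne_iff.1 hf0
  obtain ⟨w, hw⟩ := Function.ne_iff.1 hg0
  have hcard : 1 < Fintype.card V := Fintype.one_lt_card_iff.2 ⟨v, w, (hfg v w hv hw).1⟩
  have hform {h : V → ℝ} (hh : 0 ≤ h) (hl : l • h ≤ G.adjMatrix ℝ *ᵥ h) :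
      l * (h ⬝ᵥ h) ≤ h ⬝ᵥ (G.adjMatrix ℝ *ᵥ h) := by
    rw [← smul_eq_mul, ← dotProduct_smul]
    exact dotProduct_le_dotProduct_of_nonneg_left hl hh
  have horth : f ⬝ᵥ g = 0 := sum_eq_zero fun x _ => by
    by_contra hx
    exact (hfg x x (left_ne_zero_of_mul hx) (right_ne_zero_of_mul hx)).1 rfl
  have horthA : f ⬝ᵥ (G.adjMatrix ℝ *ᵥ g) = 0 := sum_eq_zero fun x _ => by
    rw [SimpleGraph.adjMatrix_mulVec_apply, mul_sum]
    refine sum_eq_zero fun y hy => ?_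
    by_contra hxy
    exact (hfg x y (left_ne_zero_of_mul hxy) (right_ne_zero_of_mul hxy)).2
      ((G.mem_neighborFinset x y).1 hy)
  have horthA' : g ⬝ᵥ (G.adjMatrix ℝ *ᵥ f) = 0 := by
    rw [dotProduct_comm, ← Matrix.vecMul_transpose, SimpleGraph.transpose_adjMatrix,
      ← Matrix.dotProduct_mulVec, horthA]
  rw [secondEigenvalue, dif_pos hcard]
  refine le_eigenvalues₀_of_orthogonal _ (f := ![f, g]) ?_ ?_ ?_ ?_ (by simp)
  · simp [Fin.forall_fin_two, hf0, hg0]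
  · simpa only [Fin.forall_fin_two] using ⟨hform hf hlf, hform hg hlg⟩
  · simp [Pairwise, Fin.forall_fin_two, horth, dotProduct_comm g f]
  · simp [Pairwise, Fin.forall_fin_two, horthA, horthA']

lemma neg_le_secondEigenvalue {d : ℕ} (hd : ∀ v, G.degree v ≤ d) :
    -(d : ℝ) ≤ secondEigenvalue G := by
  classical
  have hinst : ‹DecidableRel G.Adj› = fun _ _ => Classical.propDecidable _ :=
    Subsingleton.elim _ _
  subst hinst
  rw [secondEigenvalue]
  split_ifs with h
  · have hA := G.isHermitian_adjMatrix ℝ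
    set i := Fintype.equivOfCardEq (Fintype.card_fin _) (⟨1, h⟩ : Fin (Fintype.card V))
    have hval : hA.eigenvalues i = hA.eigenvalues₀ ⟨1, h⟩ := by
      simp [Matrix.IsHermitian.eigenvalues, i]
    have hmem := hA.eigenvalues_mem_spectrum_real i
    rw [← Matrix.spectrum_toLin', ← Module.End.hasEigenvalue_iff_mem_spectrum] at hmem
    obtain ⟨v, hv⟩ := eigenvalue_mem_ball hmem
    have hsum : ∑ w ∈ univ.erase v, ‖G.adjMatrix ℝ v w‖ ≤ d := by
      refine (sum_le_univ_sum_of_nonneg fun _ => norm_nonneg _).trans ?_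
      simpa [SimpleGraph.adjMatrix_apply, apply_ite, ← SimpleGraph.card_neighborFinset_eq_degree,
        SimpleGraph.neighborFinset_eq_filter] using hd v
    rw [Metric.mem_closedBall, Real.dist_eq, SimpleGraph.adjMatrix_apply, if_neg (G.irrefl),
      sub_zero, hval] at hv
    linarith [neg_abs_le (hA.eigenvalues₀ ⟨1, h⟩)]
  · simp

end SecondEigenvalue

/-! ### Links -/

section Links

variable {V : Type*} [Fintype V]

lemma IsEdgeExpander.le_card_interedges [DecidableEq V] {H : SimpleGraph V} [DecidableRel H.Adj]
    {δ : ℝ} (h : IsEdgeExpander H δ) (U : Finset V) :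
    δ * min (#U : ℝ) (#Uᶜ : ℝ) ≤ #(H.interedges U Uᶜ) := by
  convert h U

variable {G : SimpleGraph V} {a b : ℕ} {δ : ℝ} {v : V} {S : Finset V}

lemma IsABRegular.isRegularOfDegree [DecidableRel G.Adj] (hG : IsABRegular G a b) :
    G.IsRegularOfDegree a := by
  convert hG.1

lemma IsABRegular.card_neighborFinset [DecidableRel G.Adj] (hG : IsABRegular G a b) (v : V) :
    #(G.neighborFinset v) = a :=
  (G.card_neighborFinset_eq_degree v).trans (hG.isRegularOfDegree v)

lemma IsABRegular.card_inter_neighborFinset [DecidableEq V] [DecidableRel G.Adj]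
    (hG : IsABRegular G a b) {u : V} (hvu : G.Adj v u) :
    #(G.neighborFinset v ∩ G.neighborFinset u) = b := by
  classical
  rw [← hG.2 v ⟨u, hvu⟩, ← SimpleGraph.card_neighborFinset_eq_degree,
    ← card_map (Function.Embedding.subtype _)]
  congr 1
  ext w
  simp [and_comm]

lemma LinksExpand.le_card_interedges [DecidableEq V] [DecidableRel G.Adj]
    (h : LinksExpand G δ) (hS : S ⊆ G.neighborFinset v) :
    δ * min (#S : ℝ) (#(G.neighborFinset v \ S) : ℝ)
      ≤ #(G.interedges S (G.neighborFinset v \ S)) := by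
  classical
  have hinst : ‹DecidableRel G.Adj› = fun _ _ => Classical.propDecidable _ :=
    Subsingleton.elim _ _
  subst hinst
  have hexp := (h v).le_card_interedges (S.subtype (· ∈ G.neighborSet v))
  have hmap : (S.subtype (· ∈ G.neighborSet v)).map (Function.Embedding.subtype _) = S :=
    subtype_map_of_mem fun x hx => (G.mem_neighborFinset v x).1 (hS hx)
  have hmap_compl : ((S.subtype (· ∈ G.neighborSet v))ᶜ).map (Function.Embedding.subtype _)
      = G.neighborFinset v \ S := by
    ext w
    simp [and_comm]
  rw [← card_map (Function.Embedding.subtype _), hmap,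
    ← card_map (s := _ᶜ) (Function.Embedding.subtype _), hmap_compl] at hexp
  refine hexp.trans (Nat.cast_le.2 (card_le_card_of_injOn (Prod.map (↑) (↑)) ?_
    (Subtype.val_injective.prodMap Subtype.val_injective).injOn))
  rintro ⟨x, y, hy⟩ hxy
  have hvy : G.Adj v y := hy
  simpa [SimpleGraph.mem_interedges_iff, hvy] using hxy

lemma LinksExpand.eq_neighborFinset_of_closed [DecidableRel G.Adj] (h : LinksExpand G δ)
    (hδ : 0 < δ) (hS : S ⊆ G.neighborFinset v) (hne : S.Nonempty)
    (hclosed : ∀ x ∈ S, ∀ y ∈ G.neighborFinset v, G.Adj x y → y ∈ S) :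
    S = G.neighborFinset v := by
  classical
  have hedges : G.interedges S (G.neighborFinset v \ S) = ∅ := by
    refine eq_empty_of_forall_notMem fun ⟨x, y⟩ hxy => ?_
    obtain ⟨hx, hy, hadj⟩ := (SimpleGraph.mem_interedges_iff _).1 hxy
    exact (mem_sdiff.1 hy).2 (hclosed x hx y (mem_sdiff.1 hy).1 hadj)
  have hle := h.le_card_interedges hS
  rw [hedges, card_empty, Nat.cast_zero] at hle
  have hcompl : (#(G.neighborFinset v \ S) : ℝ) ≤ 0 :=
    (min_le_iff.1 (nonpos_of_mul_nonpos_right hle hδ)).resolve_left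
      (Nat.cast_pos.2 (card_pos.2 hne)).not_ge
  exact hS.antisymm (sdiff_eq_empty_iff_subset.1 (card_eq_zero.1
    (Nat.le_zero.1 (by exact_mod_cast hcompl))))

lemma LinksExpand.le_degree (h : LinksExpand G δ) (hG : IsABRegular G a b) (ha : 2 ≤ a) (v : V) :
    δ ≤ b := by
  classical
  obtain ⟨u, hu⟩ : (G.neighborFinset v).Nonempty := by
    rw [← card_pos, hG.card_neighborFinset]; omega
  have hvu := (G.mem_neighborFinset v u).1 hu
  have hle := h.le_card_interedges (singleton_subset_iff.2 hu)
  have hcard : #(G.neighborFinset v \ {u}) = a - 1 := by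
    rw [card_sdiff_of_subset (singleton_subset_iff.2 hu), hG.card_neighborFinset, card_singleton]
  have hmin : (1 : ℝ) ≤ ((a - 1 : ℕ) : ℝ) := by exact_mod_cast Nat.le_sub_one_of_lt ha
  have hedges : G.interedges {u} (G.neighborFinset v \ {u})
      = {u} ×ˢ (G.neighborFinset v ∩ G.neighborFinset u) := by
    ext ⟨x, y⟩
    simp only [SimpleGraph.mem_interedges_iff, mem_product, mem_singleton, Finset.mem_sdiff,
      mem_inter, SimpleGraph.mem_neighborFinset]
    refine and_congr_right ?_
    rintro rfl
    exact ⟨fun hy => ⟨hy.1.1, hy.2⟩, fun hy => ⟨⟨hy.1, hy.2.ne'⟩, hy.2⟩⟩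
  rwa [hcard, card_singleton, Nat.cast_one, min_eq_left hmin, mul_one, hedges, card_product,
    card_singleton, one_mul, hG.card_inter_neighborFinset hvu] at hle

/- In a `b`-regular graph with `b ≤ 1` the component of a vertex consists of it and its
neighbours. -/
lemma LinksExpand.eq_add_one_of_le_one [Nonempty V] (h : LinksExpand G δ)
    (hG : IsABRegular G a b) (hδ : 0 < δ) (hb : b ≤ 1) (ha : 0 < a) : a = b + 1 := by
  classical
  obtain ⟨v⟩ := ‹Nonempty V›
  obtain ⟨u, hu⟩ : (G.neighborFinset v).Nonempty := by
    rwa [← card_pos, hG.card_neighborFinset]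
  have hvu := (G.mem_neighborFinset v u).1 hu
  rw [← hG.card_neighborFinset v, ← h.eq_neighborFinset_of_closed (v := v) hδ
    (insert_subset hu inter_subset_left)
    (insert_nonempty u (G.neighborFinset v ∩ G.neighborFinset u)) ?_,
    card_insert_of_notMem (by simp), hG.card_inter_neighborFinset hvu]
  intro x hx y hy hxy
  obtain rfl | hx := mem_insert.1 hx
  · exact mem_insert_of_mem (mem_inter.2 ⟨hy, (G.mem_neighborFinset x y).2 hxy⟩)
  · rw [mem_inter, SimpleGraph.mem_neighborFinset, SimpleGraph.mem_neighborFinset] at hx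
    have hone : #(G.neighborFinset v ∩ G.neighborFinset x) ≤ 1 :=
      (hG.card_inter_neighborFinset hx.1).trans_le hb
    have huy : u = y := card_le_one.1 hone u (by simpa [hx.2.symm] using hu)
      y (by simpa [hxy] using hy)
    exact mem_insert.2 (Or.inl huy.symm)

end Links

/-! ### The test function of a profile -/

section TestFunction

variable {V : Type*} {G : SimpleGraph V} {v x y : V}

lemma dist_le_dist_add_one_of_adj (v : V) (h : G.Adj x y) : G.dist v y ≤ G.dist v x + 1 := by
  rcases h.diff_dist_adj (u := v) with h | h | h <;> omega

variable [Fintype V]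

open Classical in
/-- The neighbours of `x` that are closer to the root `v` than `x`. -/
noncomputable def lowerNeighbors (G : SimpleGraph V) (v x : V) : Finset V :=
  {y | G.Adj x y ∧ G.dist v y + 1 = G.dist v x}

open Classical in
/-- The neighbours of `x` that are further away from the root `v` than `x`. -/
noncomputable def upperNeighbors (G : SimpleGraph V) (v x : V) : Finset V :=
  {y | G.Adj x y ∧ G.dist v y = G.dist v x + 1}

@[simp] lemma mem_lowerNeighbors :
    y ∈ lowerNeighbors G v x ↔ G.Adj x y ∧ G.dist v y + 1 = G.dist v x := by
  simp [lowerNeighbors]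

@[simp] lemma mem_upperNeighbors :
    y ∈ upperNeighbors G v x ↔ G.Adj x y ∧ G.dist v y = G.dist v x + 1 := by
  simp [upperNeighbors]

lemma upperNeighbors_subset [DecidableRel G.Adj] : upperNeighbors G v x ⊆ G.neighborFinset x :=
  fun y hy => (G.mem_neighborFinset x y).2 (mem_upperNeighbors.1 hy).1

lemma mem_neighborFinset_sdiff_upperNeighbors [DecidableEq V] [DecidableRel G.Adj] :
    y ∈ G.neighborFinset x \ upperNeighbors G v x ↔ G.Adj x y ∧ G.dist v y ≤ G.dist v x := by
  rw [Finset.mem_sdiff, SimpleGraph.mem_neighborFinset, mem_upperNeighbors]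
  refine and_congr_right fun h => ?_
  have := dist_le_dist_add_one_of_adj v h
  simp only [h, true_and]
  omega

lemma lowerNeighbors_nonempty (h : G.Reachable v x) (hx : v ≠ x) :
    (lowerNeighbors G v x).Nonempty := by
  obtain ⟨p, hp⟩ := h.symm.exists_walk_length_eq_dist
  cases p with
  | nil => exact absurd rfl hx
  | @cons _ y _ hadj q =>
    refine ⟨y, mem_lowerNeighbors.2 ⟨hadj, ?_⟩⟩
    have hq := SimpleGraph.dist_le q
    have hstep := dist_le_dist_add_one_of_adj v hadj.symm
    rw [SimpleGraph.Walk.length_cons, SimpleGraph.dist_comm] at hp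
    rw [SimpleGraph.dist_comm] at hq
    omega

lemma one_le_card_lowerNeighbors (h : G.Reachable v x) (hx : v ≠ x) :
    (1 : ℝ) ≤ #(lowerNeighbors G v x) := by
  exact_mod_cast (lowerNeighbors_nonempty h hx).card_pos

/-- The function on the vertices obtained from a profile `Y`: at distance `i` from the root `v` its
value is `Y i` plus a bonus of `(Y (i - 1) - Y i) / Λ` for each lower neighbour beyond the first.
Vertices that cannot be reached from `v` get the value `0`, as `G.dist` is `0` there; at the root
the truncated `0 - 1 = 0` makes the bonus vanish. -/
noncomputable def testFun (G : SimpleGraph V) (v : V) (Y : ℕ → ℝ) (Λ : ℝ) (x : V) : ℝ :=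
  open Classical in
  if G.Reachable v x then
    Y (G.dist v x)
      + (Y (G.dist v x - 1) - Y (G.dist v x)) / Λ * ((#(lowerNeighbors G v x) : ℝ) - 1)
  else 0

variable {Y : ℕ → ℝ} {Λ : ℝ}

lemma testFun_root : testFun G v Y Λ v = Y 0 := by
  simp [testFun]

lemma le_testFun (hY : Antitone Y) (hΛ : 0 < Λ) (hx : G.Reachable v x) :
    Y (G.dist v x) ≤ testFun G v Y Λ x := by
  obtain rfl | hne := eq_or_ne v x
  · simp [testFun_root]
  rw [testFun, if_pos hx, le_add_iff_nonneg_right]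
  exact mul_nonneg (div_nonneg (sub_nonneg.2 (hY (Nat.sub_le _ _))) hΛ.le)
    (sub_nonneg.2 (one_le_card_lowerNeighbors hx hne))

lemma testFun_nonneg (hY : Antitone Y) (hY₀ : 0 ≤ Y) (hΛ : 0 < Λ) : 0 ≤ testFun G v Y Λ := by
  intro x
  by_cases hx : G.Reachable v x
  · exact (hY₀ _).trans (le_testFun hY hΛ hx)
  · simp [testFun, hx]

lemma edist_le_of_testFun_ne_zero {R : ℕ} (hY : ∀ i, R ≤ i → Y i = 0)
    (h : testFun G v Y Λ x ≠ 0) : G.edist v x ≤ R := by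
  by_cases hx : G.Reachable v x
  · rw [← hx.coe_dist_eq_edist, Nat.cast_le]
    by_contra! hlt
    refine h ?_
    rw [testFun, if_pos hx, hY _ hlt.le, hY _ (Nat.le_sub_one_of_lt hlt)]
    simp
  · simp [testFun, hx] at h

variable {a b : ℕ} {δ : ℝ}

/- Each edge of the link of `x` from an upper neighbour `u` to another neighbour `y` of `x` makes
`y`, besides `x`, a lower neighbour of `u`. -/
lemma LinksExpand.le_sum_upperNeighbors [DecidableEq V] [DecidableRel G.Adj]
    (h : LinksExpand G δ) (v x : V) :
    δ * min (#(upperNeighbors G v x) : ℝ) (#(G.neighborFinset x \ upperNeighbors G v x) : ℝ)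
      ≤ ∑ u ∈ upperNeighbors G v x, ((#(lowerNeighbors G v u) : ℝ) - 1) := by
  refine (h.le_card_interedges upperNeighbors_subset).trans ?_
  rw [card_eq_sum_card_fiberwise (f := Prod.fst) (t := upperNeighbors G v x)
    fun e he => ((SimpleGraph.mem_interedges_iff _).1 he).1, Nat.cast_sum]
  refine sum_le_sum fun u hu => ?_
  obtain ⟨hxu, hdist⟩ := mem_upperNeighbors.1 hu
  have hx : x ∈ lowerNeighbors G v u := mem_lowerNeighbors.2 ⟨hxu.symm, hdist.symm⟩
  rw [← Nat.cast_one, ← Nat.cast_sub (card_pos.2 ⟨x, hx⟩), ← card_erase_of_mem hx, Nat.cast_le]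
  refine card_le_card_of_injOn Prod.snd ?_ ?_
  · rintro ⟨u', y⟩ he
    obtain ⟨hmem, rfl : u' = u⟩ := mem_filter.1 (mem_coe.1 he)
    obtain ⟨-, hy, hadj⟩ := (SimpleGraph.mem_interedges_iff _).1 hmem
    obtain ⟨hxy, hdy⟩ := mem_neighborFinset_sdiff_upperNeighbors.1 hy
    refine mem_erase.2 ⟨hxy.ne', mem_lowerNeighbors.2 ⟨hadj, ?_⟩⟩
    have := dist_le_dist_add_one_of_adj v hadj.symm
    dsimp only at this hdist hdy ⊢
    omega
  · rintro ⟨u₁, y₁⟩ h₁ ⟨u₂, y₂⟩ h₂ rfl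
    exact Prod.ext ((mem_filter.1 h₁).2.trans (mem_filter.1 h₂).2.symm) rfl

lemma IsABRegular.add_one_le_card_sdiff_upperNeighbors [DecidableEq V] [DecidableRel G.Adj]
    (hG : IsABRegular G a b) (hx : G.Reachable v x) (hne : v ≠ x) :
    b + 1 ≤ #(G.neighborFinset x \ upperNeighbors G v x) := by
  obtain ⟨z, hz⟩ := lowerNeighbors_nonempty hx hne
  obtain ⟨hxz, hdist⟩ := mem_lowerNeighbors.1 hz
  rw [← hG.card_inter_neighborFinset hxz, ← card_insert_of_notMem (a := z) (by simp)]
  refine card_le_card (insert_subset ?_ fun y hy => ?_)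
  · exact mem_neighborFinset_sdiff_upperNeighbors.2 ⟨hxz, by omega⟩
  · rw [mem_inter, SimpleGraph.mem_neighborFinset, SimpleGraph.mem_neighborFinset] at hy
    have := dist_le_dist_add_one_of_adj v hy.2
    exact mem_neighborFinset_sdiff_upperNeighbors.2 ⟨hy.1, by omega⟩

lemma le_sum_testFun_sdiff_upperNeighbors [DecidableEq V] [DecidableRel G.Adj] {i : ℕ}
    (hY : Antitone Y) (hΛ : 0 < Λ) (hx : G.Reachable v x) (hi : G.dist v x = i + 1) :
    #(lowerNeighbors G v x) * Y i
        + ((#(G.neighborFinset x \ upperNeighbors G v x) : ℝ) - #(lowerNeighbors G v x)) * Y (i + 1)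
      ≤ ∑ y ∈ G.neighborFinset x \ upperNeighbors G v x, testFun G v Y Λ y := by
  have hsub : lowerNeighbors G v x ⊆ G.neighborFinset x \ upperNeighbors G v x := by
    intro y hy
    obtain ⟨hxy, hdist⟩ := mem_lowerNeighbors.1 hy
    exact mem_neighborFinset_sdiff_upperNeighbors.2 ⟨hxy, by omega⟩
  have hle : ∀ {y j}, G.Adj x y → G.dist v y ≤ j → Y j ≤ testFun G v Y Λ y := fun hxy hj =>
    (hY hj).trans (le_testFun hY hΛ (hx.trans hxy.reachable))
  rw [← sum_sdiff hsub, add_comm, ← Nat.cast_sub (card_le_card hsub),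
    ← card_sdiff_of_subset hsub, ← nsmul_eq_mul, ← nsmul_eq_mul]
  refine add_le_add (card_nsmul_le_sum _ _ _ fun y hy => ?_)
    (card_nsmul_le_sum _ _ _ fun y hy => ?_)
  · obtain ⟨hxy, hdist⟩ := mem_neighborFinset_sdiff_upperNeighbors.1 (Finset.mem_sdiff.1 hy).1
    exact hle hxy (hdist.trans_eq hi)
  · obtain ⟨hxy, hdist⟩ := mem_lowerNeighbors.1 hy
    exact hle hxy (by omega)

lemma sum_testFun_upperNeighbors {i : ℕ} (hx : G.Reachable v x) (hi : G.dist v x = i + 1) :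
    ∑ y ∈ upperNeighbors G v x, testFun G v Y Λ y
      = #(upperNeighbors G v x) * Y (i + 2) + (Y (i + 1) - Y (i + 2)) / Λ
        * ∑ y ∈ upperNeighbors G v x, ((#(lowerNeighbors G v y) : ℝ) - 1) := by
  rw [mul_sum, ← nsmul_eq_mul, ← sum_const, ← sum_add_distrib]
  refine sum_congr rfl fun y hy => ?_
  obtain ⟨hxy, hdist⟩ := mem_upperNeighbors.1 hy
  rw [testFun, if_pos (hx.trans hxy.reachable), hdist, hi]
  rfl

/- The extreme case is `m = b + 1`: increasing `m` by one costs `δ ≤ Λ` in the bound on `T`, but it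
moves one neighbour from the value `y₂` to the value `y₁`. -/
lemma mul_le_of_recurrence {a b δ r l p m T y₀ y₁ y₂ : ℝ} (hΛ : 0 < Λ) (hδ : 0 ≤ δ)
    (hδΛ : δ ≤ Λ) (hlΛ : l ≤ Λ) (hr : r ≤ δ * min (b + 1) (a - b - 1)) (hp : 1 ≤ p)
    (hm : b + 1 ≤ m) (hT : δ * min (a - m) m ≤ T) (hy₁ : y₁ ≤ y₀) (hy₂ : y₂ ≤ y₁)
    (hrec : l * y₁ ≤ y₀ + (b + r / Λ) * y₁ + (a - b - 1 - r / Λ) * y₂) :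
    l * (y₁ + (y₀ - y₁) / Λ * (p - 1))
      ≤ p * y₀ + (m - p) * y₁ + ((a - m) * y₂ + (y₁ - y₂) / Λ * T) := by
  have hmin : min (b + 1) (a - b - 1) - (m - (b + 1)) ≤ min (a - m) m :=
    le_min (by linarith [min_le_right (b + 1) (a - b - 1)])
      (by linarith [min_le_left (b + 1) (a - b - 1)])
  have hrT : r - Λ * (m - (b + 1)) ≤ T := by
    have h₁ := mul_le_mul_of_nonneg_left hmin hδ
    have h₂ := mul_le_mul_of_nonneg_right hδΛ (sub_nonneg.2 hm)
    linarith
  have hupper : r / Λ * (y₁ - y₂) - (y₁ - y₂) * (m - (b + 1)) ≤ (y₁ - y₂) / Λ * T :=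
    calc r / Λ * (y₁ - y₂) - (y₁ - y₂) * (m - (b + 1))
        = (y₁ - y₂) / Λ * (r - Λ * (m - (b + 1))) := by field_simp
      _ ≤ _ := mul_le_mul_of_nonneg_left hrT (div_nonneg (sub_nonneg.2 hy₂) hΛ.le)
  have hlower : l * ((y₀ - y₁) / Λ * (p - 1)) ≤ (y₀ - y₁) * (p - 1) :=
    calc l * ((y₀ - y₁) / Λ * (p - 1)) ≤ Λ * ((y₀ - y₁) / Λ * (p - 1)) :=
          mul_le_mul_of_nonneg_right hlΛ
            (mul_nonneg (div_nonneg (sub_nonneg.2 hy₁) hΛ.le) (sub_nonneg.2 hp))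
      _ = (y₀ - y₁) * (p - 1) := by field_simp
  linarith

lemma IsABRegular.smul_testFun_le [DecidableRel G.Adj] (hG : IsABRegular G a b)
    (hexp : LinksExpand G δ) (hδ : 0 ≤ δ) (hδΛ : δ ≤ Λ) (hΛ : 0 < Λ) {r l : ℝ} {R : ℕ}
    (hr : r ≤ δ * min ((b : ℝ) + 1) ((a : ℝ) - b - 1)) (hlΛ : l ≤ Λ) (hla : l ≤ a)
    (hY : IsProfile l (b + r / Λ) ((a : ℝ) - b - 1 - r / Λ) R Y) (v : V) :
    l • testFun G v Y Λ ≤ G.adjMatrix ℝ *ᵥ testFun G v Y Λ := by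
  classical
  intro x
  rw [Pi.smul_apply, smul_eq_mul, SimpleGraph.adjMatrix_mulVec_apply]
  by_cases hx : G.Reachable v x
  swap
  · rw [testFun, if_neg hx, mul_zero]
    exact sum_nonneg fun y _ => testFun_nonneg hY.antitone hY.nonneg hΛ y
  obtain rfl | hne := eq_or_ne v x
  · rw [testFun_root]
    refine (mul_le_mul_of_nonneg_right hla (hY.nonneg 0)).trans ?_
    rw [← hG.card_neighborFinset v, ← nsmul_eq_mul]
    refine card_nsmul_le_sum _ _ _ fun y hy => ?_
    have hvy := (G.mem_neighborFinset v y).1 hy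
    rw [hY.zero_eq_one, ← SimpleGraph.dist_eq_one_iff_adj.2 hvy]
    exact le_testFun hY.antitone hΛ hvy.reachable
  obtain ⟨i, hi⟩ := Nat.exists_eq_succ_of_ne_zero (hx.pos_dist_of_ne hne).ne'
  have hcard : (#(upperNeighbors G v x) : ℝ)
      = a - #(G.neighborFinset x \ upperNeighbors G v x) := by
    rw [eq_sub_iff_add_eq', ← hG.card_neighborFinset x]
    exact_mod_cast card_sdiff_add_card_eq_card upperNeighbors_subset
  have hsum := hexp.le_sum_upperNeighbors v x
  rw [hcard] at hsum
  rw [← sum_sdiff (upperNeighbors_subset (v := v)), sum_testFun_upperNeighbors hx hi, hcard,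
    testFun, if_pos hx, hi]
  refine (mul_le_of_recurrence hΛ hδ hδΛ hlΛ hr (one_le_card_lowerNeighbors hx hne)
    (by exact_mod_cast hG.add_one_le_card_sdiff_upperNeighbors hx hne) hsum
    (hY.antitone i.le_succ) (hY.antitone (i + 1).le_succ) (hY.recurrence i)).trans ?_
  exact add_le_add_left (le_sum_testFun_sdiff_upperNeighbors hY.antitone hΛ hx hi) _

open Classical in
lemma card_edist_le_le [DecidableRel G.Adj] {d : ℕ} (hd : ∀ v, G.degree v ≤ d) (v : V) (k : ℕ) :
    #{x : V | G.edist v x ≤ k} ≤ (d + 1) ^ k := by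
  induction k with
  | zero => simp [SimpleGraph.edist_eq_zero_iff, Finset.filter_eq]
  | succ k ih =>
    have hsub : ({x : V | G.edist v x ≤ (k + 1 : ℕ)} : Finset V) ⊆
        ({x : V | G.edist v x ≤ k} : Finset V).biUnion
          fun y => insert y (G.neighborFinset y) := by
      intro x hx
      simp only [mem_filter_univ, mem_biUnion, mem_insert, SimpleGraph.mem_neighborFinset] at hx ⊢
      by_cases h : G.edist v x ≤ k
      · exact ⟨x, h, Or.inl rfl⟩
      have hreach : G.Reachable v x := SimpleGraph.edist_ne_top_iff_reachable.1
        (ne_top_of_le_ne_top (ENat.natCast_ne_top _) hx)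
      rw [← hreach.coe_dist_eq_edist, Nat.cast_le] at hx h
      obtain ⟨y, hy⟩ := lowerNeighbors_nonempty hreach (by rintro rfl; simp at h)
      obtain ⟨hxy, hdist⟩ := mem_lowerNeighbors.1 hy
      refine ⟨y, ?_, Or.inr hxy.symm⟩
      rw [← (hreach.trans hxy.reachable).coe_dist_eq_edist, Nat.cast_le]
      omega
    calc _ ≤ _ := card_le_card hsub
      _ ≤ #{x : V | G.edist v x ≤ k} * (d + 1) := card_biUnion_le_card_mul _ _ _ fun y _ =>
          (card_insert_le _ _).trans (Nat.succ_le_succ (hd y))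
      _ ≤ (d + 1) ^ (k + 1) := Nat.mul_le_mul_right _ ih

lemma card_le_of_forall_edist_le [DecidableRel G.Adj] {d k : ℕ} (hd : ∀ v, G.degree v ≤ d)
    (h : ∀ x, G.edist v x ≤ k) : Fintype.card V ≤ (d + 1) ^ k := by
  classical
  simpa [h] using card_edist_le_le hd v k

/- Two test functions rooted at vertices at distance more than `2 * R + 1`. -/
lemma IsABRegular.le_secondEigenvalue_of_isProfile (hG : IsABRegular G a b)
    (hexp : LinksExpand G δ) (hδ : 0 ≤ δ) (hδΛ : δ ≤ Λ) (hΛ : 0 < Λ) {r l : ℝ} {R : ℕ}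
    (hr : r ≤ δ * min ((b : ℝ) + 1) ((a : ℝ) - b - 1)) (hlΛ : l ≤ Λ) (hla : l ≤ a)
    (hY : IsProfile l (b + r / Λ) ((a : ℝ) - b - 1 - r / Λ) R Y)
    (hV : (a + 1) ^ (2 * R + 1) < Fintype.card V) : l ≤ secondEigenvalue G := by
  classical
  have : Nonempty V := Fintype.card_pos_iff.1 (Nat.zero_lt_of_lt hV)
  let v := Classical.arbitrary V
  obtain ⟨w, hw⟩ : ∃ w, (2 * R + 1 : ℕ) < G.edist v w := by
    by_contra! h
    exact hV.not_ge (card_le_of_forall_edist_le (fun u => (hG.isRegularOfDegree u).le) h)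
  have hle := fun u => hG.smul_testFun_le hexp hδ hδΛ hΛ hr hlΛ hla hY u
  have hnonneg := fun u : V => testFun_nonneg (G := G) (v := u) hY.antitone hY.nonneg hΛ
  have hne : ∀ u, testFun G u Y Λ ≠ 0 := fun u h =>
    hY.zero_pos.ne' (testFun_root.symm.trans (congrFun h u))
  refine le_secondEigenvalue (hnonneg v) (hnonneg w) (hne v) (hne w) (hle v) (hle w) ?_
  intro x y hx hy
  by_contra hxy
  have hxy₁ : G.edist x y ≤ 1 := SimpleGraph.edist_le_one_iff_adj_or_eq.2 (by tauto)
  have hvx := edist_le_of_testFun_ne_zero hY.eq_zero hx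
  have hyw := SimpleGraph.edist_comm (G := G) ▸ edist_le_of_testFun_ne_zero hY.eq_zero hy
  refine hw.not_ge ?_
  calc G.edist v w ≤ G.edist v x + (G.edist x y + G.edist y w) :=
        G.edist_triangle.trans (add_le_add_right G.edist_triangle _)
    _ ≤ R + (1 + R) := add_le_add hvx (add_le_add hxy₁ hyw)
    _ = (2 * R + 1 : ℕ) := by push_cast; ring

end TestFunction

/-! ### The generic range -/

section Generic

variable {a b : ℕ} {δ : ℝ}

lemma cParam_sq (ha : b + 1 ≤ a) : cParam a b ^ 2 = (a : ℝ) - b - 1 := by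
  have : (b : ℝ) + 1 ≤ a := by exact_mod_cast ha
  exact Real.sq_sqrt (by linarith)

lemma one_lt_cParam (ha : b + 3 ≤ a) : 1 < cParam a b := by
  have : (b : ℝ) + 3 ≤ a := by exact_mod_cast ha
  rw [cParam, Real.lt_sqrt zero_le_one]
  linarith

lemma gain_eq_gainFun (ha : b + 3 ≤ a) :
    gain a b δ = gainFun b (cParam a b) (rParam a b δ) := by
  have hc := one_lt_cParam ha
  have : (b : ℝ) + 2 * cParam a b ≠ 0 := by positivity
  rw [gain, gainFun]
  field_simp
  ring

lemma min_add_one_sub_pos (ha : b + 2 ≤ a) : 0 < min ((b : ℝ) + 1) ((a : ℝ) - b - 1) := by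
  have : (b : ℝ) + 2 ≤ a := by exact_mod_cast ha
  exact lt_min (by positivity) (by linarith)

lemma rParam_pos (hb : 0 < b) (ha : b + 3 ≤ a) (hδ : 0 < δ) : 0 < rParam a b δ :=
  lt_min (mul_pos hδ (min_add_one_sub_pos (by omega)))
    (gainCap_pos (by exact_mod_cast hb) (one_lt_cParam ha))

lemma rParam_le_gainCap : rParam a b δ ≤ gainCap b (cParam a b) := min_le_right _ _

lemma gain_pos (hb : 0 < b) (ha : b + 3 ≤ a) (hδ : 0 < δ) : 0 < gain a b δ := by
  rw [gain_eq_gainFun ha]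
  exact gainFun_pos (by exact_mod_cast hb) (one_pos.trans (one_lt_cParam ha))
    (rParam_pos hb ha hδ) rParam_le_gainCap

lemma strictMonoOn_gain (hb : 0 < b) (ha : b + 3 ≤ a) :
    StrictMonoOn (gain a b) (Set.Ioc 0
      (gainCap b (cParam a b) / min ((b : ℝ) + 1) ((a : ℝ) - b - 1))) := by
  intro δ₁ h₁ δ₂ h₂ hlt
  have hmin := min_add_one_sub_pos (a := a) (b := b) (by omega)
  rw [gain_eq_gainFun ha, gain_eq_gainFun ha]
  refine strictMonoOn_gainFun (by exact_mod_cast hb) (one_pos.trans (one_lt_cParam ha))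
    ⟨(rParam_pos hb ha h₁.1).le, rParam_le_gainCap⟩
    ⟨(rParam_pos hb ha h₂.1).le, rParam_le_gainCap⟩ ?_
  calc rParam a b δ₁ ≤ δ₁ * min ((b : ℝ) + 1) ((a : ℝ) - b - 1) := min_le_left _ _
    _ < δ₂ * min ((b : ℝ) + 1) ((a : ℝ) - b - 1) := mul_lt_mul_of_pos_right hlt hmin
    _ = rParam a b δ₂ := (min_eq_left ((le_div_iff₀ hmin).1 h₂.2)).symm

lemma le_gainCap_div_min (ha : b ^ 2 + 5 * b + 5 ≤ a) :
    (b : ℝ) ≤ gainCap b (cParam a b) / min ((b : ℝ) + 1) ((a : ℝ) - b - 1) := by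
  have ha' : (b : ℝ) ^ 2 + 5 * b + 5 ≤ a := by exact_mod_cast ha
  have : (0 : ℝ) ≤ b := Nat.cast_nonneg b
  have hcb : (b : ℝ) + 2 ≤ cParam a b := Real.le_sqrt_of_sq_le (by linarith)
  set c := cParam a b
  rw [le_div_iff₀ (min_add_one_sub_pos (by nlinarith)), gainCap, le_div_iff₀ (by linarith)]
  have hquad : (b : ℝ) + c ≤ c ^ 2 := by nlinarith
  calc b * min ((b : ℝ) + 1) ((a : ℝ) - b - 1) * (b + c)
      ≤ b * (c - 1) * c ^ 2 := by
        have hmin : min ((b : ℝ) + 1) ((a : ℝ) - b - 1) ≤ c - 1 :=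
          (min_le_left _ _).trans (by linarith)
        have : 0 ≤ c - 1 := by linarith
        have : 0 ≤ b + c := by linarith
        gcongr
    _ = b * (c ^ 3 - c ^ 2) := by ring

lemma exists_forall_le_secondEigenvalue_of_lt_growthRate (hb : 0 < b) (ha : b + 3 ≤ a) (hδ : 0 < δ)
    {l : ℝ} (hl : l < growthRate b (cParam a b) (rParam a b δ)) :
    ∃ N : ℕ, ∀ (V : Type u) [Fintype V] (G : SimpleGraph V), N ≤ Fintype.card V →
      IsABRegular G a b → LinksExpand G δ → l ≤ secondEigenvalue G := by
  have hb' : (0 : ℝ) < b := by exact_mod_cast hb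
  have hc := one_lt_cParam ha
  have hc₀ := one_pos.trans hc
  have hr : rParam a b δ ∈ Set.Icc 0 (gainCap b (cParam a b)) :=
    ⟨(rParam_pos hb ha hδ).le, rParam_le_gainCap⟩
  have hLΛ := le_growthRate hb' hc₀ hr
  have hsqrt := growthRate_le_add_two_mul_sqrt hb' hc₀ hr
  have hlt := sub_pos.2 (div_growthRate_lt_sq hb' hc₀ hr)
  set Λ := growthRate b (cParam a b) (rParam a b δ)
  have hk := Real.sqrt_pos.2 hlt
  obtain ⟨R, Y, hY⟩ := exists_isProfile hk (hl.trans_le hsqrt)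
  rw [Real.sq_sqrt hlt.le, cParam_sq (by omega)] at hY
  have hla : l ≤ a := by
    have hksq := Real.sq_sqrt hlt.le
    rw [cParam_sq (by omega)] at hksq hsqrt
    linarith [two_mul_le_add_sq √((a : ℝ) - b - 1 - rParam a b δ / Λ) 1]
  refine ⟨(a + 1) ^ (2 * R + 1) + 1, fun V _ G hV hG hexp => ?_⟩
  have : Nonempty V := Fintype.card_pos_iff.1 (Nat.zero_lt_of_lt hV)
  have hδb := hexp.le_degree hG (by omega) (Classical.arbitrary V)
  exact hG.le_secondEigenvalue_of_isProfile hexp hδ.le (by linarith) (by linarith) (min_le_left _ _)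
    hl.le hla hY hV

end Generic

/-! ### The degenerate ranges -/

section Degenerate

variable {V : Type*} [Fintype V] {G : SimpleGraph V} {b : ℕ} {u v w x : V}

lemma le_secondEigenvalue_of_not_preconnected [DecidableRel G.Adj] {d : ℕ}
    (hG : G.IsRegularOfDegree d) (h : ¬ G.Preconnected) : (d : ℝ) ≤ secondEigenvalue G := by
  classical
  rw [SimpleGraph.Preconnected] at h
  push Not at h
  obtain ⟨v, w, hvw⟩ := h
  let component (u : V) : V → ℝ := fun x => if G.Reachable u x then 1 else 0
  have hnonneg (u : V) : 0 ≤ component u := fun x => by dsimp only [component]; positivity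
  have hne (u : V) : component u ≠ 0 := Function.ne_iff.2 ⟨u, by simp [component]⟩
  have hle (u : V) : (d : ℝ) • component u ≤ G.adjMatrix ℝ *ᵥ component u := by
    intro x
    have hconst : ∀ y ∈ G.neighborFinset x, component u y = component u x := fun y hy => by
      have hxy := ((G.mem_neighborFinset x y).1 hy).reachable
      simp only [component, show G.Reachable u y ↔ G.Reachable u x from
        ⟨fun h => h.trans hxy.symm, fun h => h.trans hxy⟩]
    rw [SimpleGraph.adjMatrix_mulVec_apply, sum_congr rfl hconst, sum_const,
      SimpleGraph.card_neighborFinset_eq_degree, hG x, nsmul_eq_mul, Pi.smul_apply, smul_eq_mul]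
  refine le_secondEigenvalue (hnonneg v) (hnonneg w) (hne v) (hne w) (hle v) (hle w) ?_
  intro x y hx hy
  have hvx : G.Reachable v x := by simpa [component] using hx
  have hwy : G.Reachable w y := by simpa [component] using hy
  exact ⟨fun hxy => hvw (hvx.trans (hxy ▸ hwy.symm)),
    fun hxy => hvw (hvx.trans (hxy.reachable.trans hwy.symm))⟩

lemma IsABRegular.adj_of_adj_adj (hG : IsABRegular G (b + 1) b) (huv : G.Adj u v)
    (huw : G.Adj u w) (hvw : v ≠ w) : G.Adj v w := by
  classical
  have hsub : G.neighborFinset u ∩ G.neighborFinset v ⊆ (G.neighborFinset u).erase v :=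
    subset_erase.2 ⟨inter_subset_left, by simp⟩
  have heq := eq_of_subset_of_card_le hsub (by
    rw [card_erase_of_mem (by simpa using huv), hG.card_neighborFinset,
      hG.card_inter_neighborFinset huv, Nat.add_sub_cancel])
  have hw : w ∈ (G.neighborFinset u).erase v := by simp [huw, hvw.symm]
  rw [← heq] at hw
  simpa using (mem_inter.1 hw).2

lemma IsABRegular.edist_le_one (hG : IsABRegular G (b + 1) b) (h : G.Reachable v x) :
    G.edist v x ≤ 1 := by
  rw [SimpleGraph.edist_le_one_iff_adj_or_eq]
  rw [SimpleGraph.reachable_iff_reflTransGen] at h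
  induction h with
  | refl => exact Or.inr rfl
  | @tail y x _ hyx ih =>
    obtain hvy | rfl := ih
    · exact or_iff_not_imp_right.2 (hG.adj_of_adj_adj hvy.symm hyx)
    · exact Or.inl hyx

lemma IsABRegular.le_secondEigenvalue_of_eq_add_one (hG : IsABRegular G (b + 1) b)
    (hV : b + 2 < Fintype.card V) : (b : ℝ) + 1 ≤ secondEigenvalue G := by
  classical
  have hnot : ¬ G.Preconnected := fun hconn => by
    have : Nonempty V := Fintype.card_pos_iff.1 (by omega)
    have hcard := card_le_of_forall_edist_le (k := 1) (fun u => (hG.isRegularOfDegree u).le)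
      fun x => by exact_mod_cast hG.edist_le_one (hconn (Classical.arbitrary V) x)
    rw [pow_one] at hcard
    omega
  exact_mod_cast le_secondEigenvalue_of_not_preconnected hG.isRegularOfDegree hnot

lemma IsABRegular.adj_of_adj_of_not_adj (hG : IsABRegular G (b + 2) b) (huv : G.Adj u v)
    (huw : G.Adj u w) (hvw : v ≠ w) (hnadj : ¬ G.Adj v w) (hux : G.Adj u x) (hxv : x ≠ v)
    (hxw : x ≠ w) : G.Adj v x := by
  classical
  have hsub : G.neighborFinset u ∩ G.neighborFinset v ⊆ (G.neighborFinset u \ {v, w}) := by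
    refine subset_sdiff.2 ⟨inter_subset_left, ?_⟩
    simp [disjoint_insert_right, hnadj]
  have heq := eq_of_subset_of_card_le hsub (by
    rw [card_sdiff_of_subset (by simp [insert_subset_iff, huv, huw]), hG.card_neighborFinset,
      card_pair hvw, hG.card_inter_neighborFinset huv, Nat.add_sub_cancel])
  have hx : x ∈ G.neighborFinset u \ {v, w} := by simp [hux, hxv, hxw]
  rw [← heq] at hx
  simpa using (mem_inter.1 hx).2

/- A common neighbour `z` of the two inner vertices of a path `v u y x` is adjacent to `v` in the
link of `u` and to `x` in the link of `y`. -/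
lemma IsABRegular.exists_adj_adj (hG : IsABRegular G (b + 2) b) (hb : 0 < b) {y : V}
    (hvu : G.Adj v u) (huy : G.Adj u y) (hyx : G.Adj y x) (hvy : v ≠ y) (hvy' : ¬ G.Adj v y)
    (hux : u ≠ x) (hux' : ¬ G.Adj u x) : ∃ z, G.Adj v z ∧ G.Adj z x := by
  classical
  obtain ⟨z, hz⟩ : (G.neighborFinset u ∩ G.neighborFinset y).Nonempty := by
    rwa [← card_pos, hG.card_inter_neighborFinset huy]
  rw [mem_inter, SimpleGraph.mem_neighborFinset, SimpleGraph.mem_neighborFinset] at hz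
  refine ⟨z, hG.adj_of_adj_of_not_adj hvu.symm huy hvy hvy' hz.1 ?_ hz.2.ne',
    (hG.adj_of_adj_of_not_adj hyx huy.symm hux.symm (fun h => hux' h.symm) hz.2 ?_ hz.1.ne').symm⟩
  · rintro rfl
    exact hvy' hz.2.symm
  · rintro rfl
    exact hux' hz.1

lemma IsABRegular.edist_le_two (hG : IsABRegular G (b + 2) b) (hb : 0 < b)
    (h : G.Reachable v x) : G.edist v x ≤ 2 := by
  suffices hwalk : v = x ∨ G.Adj v x ∨ ∃ u, G.Adj v u ∧ G.Adj u x by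
    rcases hwalk with rfl | hvx | ⟨u, hvu, hux⟩
    · simp
    · exact (SimpleGraph.edist_le_one_iff_adj_or_eq.2 (Or.inl hvx)).trans one_le_two
    · exact SimpleGraph.Walk.edist_le (.cons hvu (.cons hux .nil))
  rw [SimpleGraph.reachable_iff_reflTransGen] at h
  induction h with
  | refl => exact Or.inl rfl
  | @tail y x _ hyx ih =>
    rcases ih with rfl | hvy | ⟨u, hvu, huy⟩
    · exact Or.inr (Or.inl hyx)
    · exact Or.inr (Or.inr ⟨y, hvy, hyx⟩)
    by_cases hvy : v = y
    · exact Or.inr (Or.inl (hvy ▸ hyx))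
    by_cases hvy' : G.Adj v y
    · exact Or.inr (Or.inr ⟨y, hvy', hyx⟩)
    by_cases hux : u = x
    · exact Or.inr (Or.inl (hux ▸ hvu))
    by_cases hux' : G.Adj u x
    · exact Or.inr (Or.inr ⟨u, hvu, hux'⟩)
    exact Or.inr (Or.inr (hG.exists_adj_adj hb hvu huy hyx hvy hvy' hux hux'))

lemma IsABRegular.card_le_of_connected (hG : IsABRegular G (b + 2) b) (hb : 0 < b)
    (hconn : G.Connected) : Fintype.card V ≤ (b + 3) ^ 2 := by
  classical
  obtain ⟨v⟩ := hconn.nonempty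
  exact card_le_of_forall_edist_le (fun u => (hG.isRegularOfDegree u).le)
    fun x => by exact_mod_cast hG.edist_le_two hb (hconn.preconnected v x)

end Degenerate

/-! ### The gain function -/

section Epsilon

open Classical in
/-- The function `ε` of the theorem. Outside the generic range `2 ≤ b`, `b + 3 ≤ a` its value only
matters for `a = b + 1`, where it has to satisfy `b * ε ≤ 1`: in the other cases the number of
vertices is bounded. -/
noncomputable def epsilon (a b : ℕ) (δ : ℝ) : ℝ :=
  if 2 ≤ b ∧ b + 3 ≤ a then Real.exp (gain a b δ) - 1 else δ / ((b + 1) * (1 + δ))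

variable {a b : ℕ} {δ : ℝ}

lemma epsilon_of_generic (h : 2 ≤ b ∧ b + 3 ≤ a) :
    epsilon a b = fun δ : ℝ => Real.exp (gain a b δ) - 1 :=
  funext fun _ => if_pos h

lemma epsilon_of_not_generic (h : ¬ (2 ≤ b ∧ b + 3 ≤ a)) :
    epsilon a b = fun δ : ℝ => δ / (((b : ℝ) + 1) * (1 + δ)) :=
  funext fun _ => if_neg h

lemma epsilon_pos (hδ : 0 < δ) : 0 < epsilon a b δ := by
  by_cases h : 2 ≤ b ∧ b + 3 ≤ a
  · rw [epsilon_of_generic h, sub_pos, Real.one_lt_exp_iff]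
    exact gain_pos (by omega) h.2 hδ
  · rw [epsilon_of_not_generic h]
    positivity

lemma strictMonoOn_epsilon_of_generic (h : 2 ≤ b ∧ b + 3 ≤ a) :
    StrictMonoOn (epsilon a b) (Set.Ioc 0
      (gainCap b (cParam a b) / min ((b : ℝ) + 1) ((a : ℝ) - b - 1))) := by
  rw [epsilon_of_generic h]
  exact fun δ₁ h₁ δ₂ h₂ hlt => sub_lt_sub_right
    (Real.exp_lt_exp.2 (strictMonoOn_gain (by omega) h.2 h₁ h₂ hlt)) 1

lemma strictMonoOn_epsilon_of_not_generic (h : ¬ (2 ≤ b ∧ b + 3 ≤ a)) :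
    StrictMonoOn (epsilon a b) (Set.Ioi 0) := by
  rw [epsilon_of_not_generic h]
  intro δ₁ (h₁ : 0 < δ₁) δ₂ (h₂ : 0 < δ₂) hlt
  rw [div_lt_div_iff₀ (by positivity) (by positivity)]
  have : (0 : ℝ) < b + 1 := by positivity
  nlinarith

lemma strictMonoOn_epsilon_of_large (ha : b ^ 2 + 5 * b + 5 ≤ a) :
    StrictMonoOn (epsilon a b) (Set.Ioc 0 (b : ℝ)) := by
  by_cases h : 2 ≤ b ∧ b + 3 ≤ a
  · exact (strictMonoOn_epsilon_of_generic h).mono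
      (Set.Ioc_subset_Ioc_right (le_gainCap_div_min ha))
  · exact (strictMonoOn_epsilon_of_not_generic h).mono Set.Ioc_subset_Ioi_self

lemma exists_strictMonoOn_epsilon (a b : ℕ) :
    ∃ δ₀ : ℝ, 0 < δ₀ ∧ StrictMonoOn (epsilon a b) (Set.Ioo 0 δ₀) := by
  by_cases h : 2 ≤ b ∧ b + 3 ≤ a
  · have hb : (0 : ℝ) < b := by exact_mod_cast two_pos.trans_le h.1
    exact ⟨_, div_pos (gainCap_pos hb (one_lt_cParam h.2)) (min_add_one_sub_pos (by omega)),
      (strictMonoOn_epsilon_of_generic h).mono Set.Ioo_subset_Ioc_self⟩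
  · exact ⟨1, one_pos, (strictMonoOn_epsilon_of_not_generic h).mono Set.Ioo_subset_Ioi_self⟩

lemma mul_one_add_epsilon_le (b : ℕ) (hδ : 0 < δ) :
    (b : ℝ) * (1 + epsilon (b + 1) b δ) ≤ b + 1 := by
  rw [epsilon_of_not_generic (by omega), mul_add, mul_one, mul_div_assoc', add_le_add_iff_left,
    div_le_one (by positivity)]
  exact mul_le_mul (by linarith) (by linarith) hδ.le (by positivity)

end Epsilon

section ErrorTerm

/-- The second eigenvalues of the graphs on `n` vertices that the theorem is about. -/
def secondEigenvalues (a b : ℕ) (δ : ℝ) (n : ℕ) : Set ℝ :=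
  {μ | ∃ (V : Type u) (_ : Fintype V) (G : SimpleGraph V), Fintype.card V = n ∧
    IsABRegular G a b ∧ LinksExpand G δ ∧ (a = b + 2 → G.Connected) ∧ secondEigenvalue G = μ}

variable {a b : ℕ} {δ : ℝ}

lemma bddBelow_secondEigenvalues (a b : ℕ) (δ : ℝ) (n : ℕ) :
    BddBelow (secondEigenvalues.{u} a b δ n) := by
  classical
  refine ⟨-(a : ℝ), ?_⟩
  rintro _ ⟨V, _, G, -, hG, -, -, rfl⟩
  exact neg_le_secondEigenvalue fun v => (hG.isRegularOfDegree v).le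

lemma eventually_le_secondEigenvalues (hab : b < a) (hδ : 0 < δ) {l : ℝ}
    (hl : l < ((b : ℝ) + 2 * √((a : ℝ) - b - 1)) * (1 + epsilon a b δ)) :
    ∀ᶠ n in atTop, ∀ μ ∈ secondEigenvalues.{u} a b δ n, l ≤ μ := by
  by_cases h : 2 ≤ b ∧ b + 3 ≤ a
  · rw [epsilon_of_generic h, add_sub_cancel, gain_eq_gainFun h.2] at hl
    obtain ⟨N, hN⟩ :=
      exists_forall_le_secondEigenvalue_of_lt_growthRate (two_pos.trans_le h.1) h.2 hδ hl
    filter_upwards [eventually_ge_atTop N]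
    rintro _ hn _ ⟨V, _, G, rfl, hG, hexp, -, rfl⟩
    exact hN V G hn hG hexp
  filter_upwards [eventually_gt_atTop ((b + 3) ^ 2)]
  rintro _ hn _ ⟨V, _, G, rfl, hG, hexp, hconn, rfl⟩
  have hV : b + 3 < Fintype.card V := (Nat.le_self_pow two_ne_zero _).trans_lt hn
  have : Nonempty V := Fintype.card_pos_iff.1 (by omega)
  obtain rfl | hab : a = b + 1 ∨ b + 2 ≤ a := by omega
  · refine hl.le.trans (le_trans ?_ (hG.le_secondEigenvalue_of_eq_add_one (by omega)))
    simpa using mul_one_add_epsilon_le b hδ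
  have hb : 2 ≤ b := by
    by_contra hb
    have := hexp.eq_add_one_of_le_one hG hδ (by omega) (by omega)
    omega
  obtain rfl : a = b + 2 := by omega
  exact absurd (hG.card_le_of_connected (by omega) (hconn rfl)) hn.not_ge

lemma exists_tendsto_zero_forall_sub_le {S : ℕ → Set ℝ} {L : ℝ} (hS : ∀ n, BddBelow (S n))
    (h : ∀ l < L, ∀ᶠ n in atTop, ∀ μ ∈ S n, l ≤ μ) :
    ∃ o : ℕ → ℝ, Tendsto o atTop (𝓝 0) ∧ ∀ n, ∀ μ ∈ S n, L - o n ≤ μ := by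
  have hbdd (n : ℕ) : BddBelow (insert L (S n)) := (hS n).insert L
  refine ⟨fun n => L - sInf (insert L (S n)), ?_, fun n μ hμ => ?_⟩
  · suffices hlim : Tendsto (fun n => sInf (insert L (S n))) atTop (𝓝 L) by
      simpa using hlim.const_sub L
    refine tendsto_order.2 ⟨fun l hl => ?_, fun l hl => Eventually.of_forall fun n =>
      (csInf_le (hbdd n) (Set.mem_insert L _)).trans_lt hl⟩
    obtain ⟨l', hll', hl'⟩ := exists_between hl
    filter_upwards [h l' hl'] with n hn
    refine hll'.trans_le (le_csInf (Set.insert_nonempty L _) ?_)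
    rintro μ (rfl | hμ)
    exacts [hl'.le, hn μ hμ]
  · rw [sub_sub_cancel]
    exact csInf_le (hbdd n) (Set.mem_insert_of_mem L hμ)

end ErrorTerm

end LocalGlobal

theorem theorem2 :
    ∃ ε : ℕ → ℕ → ℝ → ℝ,
      -- positivity and the lower bound on the second eigenvalue
      (∀ a b : ℕ, b < a → ∀ δ : ℝ, 0 < δ →
        0 < ε a b δ ∧
        ∃ o : ℕ → ℝ, Filter.Tendsto o Filter.atTop (nhds 0) ∧
          ∀ (V : Type u) [Fintype V] (G : SimpleGraph V),
            LocalGlobal.IsABRegular G a b → LocalGlobal.LinksExpand G δ →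
            (a = b + 2 → G.Connected) →
            ((b : ℝ) + 2 * √((a : ℝ) - b - 1)) * (1 + ε a b δ) - o (Fintype.card V)
              ≤ LocalGlobal.secondEigenvalue G) ∧
      -- the value of `ε` outside the degenerate ranges
      (∀ a b : ℕ, 2 ≤ b → b + 3 ≤ a → ∀ δ : ℝ, 0 < δ →
        ε a b δ = Real.exp (LocalGlobal.gain a b δ) - 1) ∧
      -- monotonicity in `δ` for large `a`; links that are `b`-regular on at least two vertices
      -- have edge expansion at most `b`
      (∀ a b : ℕ, b ^ 2 + 5 * b + 5 ≤ a → StrictMonoOn (ε a b) (Set.Ioc 0 (b : ℝ))) ∧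
      -- monotonicity for small `δ`
      (∀ a b : ℕ, b < a → ∃ δ₀ : ℝ, 0 < δ₀ ∧ StrictMonoOn (ε a b) (Set.Ioo 0 δ₀)) := by
  refine ⟨LocalGlobal.epsilon, fun a b hab δ hδ => ⟨LocalGlobal.epsilon_pos hδ, ?_⟩,
    fun a b hb ha δ _ => congrFun (LocalGlobal.epsilon_of_generic ⟨hb, ha⟩) δ,
    fun a b ha => LocalGlobal.strictMonoOn_epsilon_of_large ha,
    fun a b _ => LocalGlobal.exists_strictMonoOn_epsilon a b⟩
  obtain ⟨o, ho, hle⟩ := LocalGlobal.exists_tendsto_zero_forall_sub_le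
    (LocalGlobal.bddBelow_secondEigenvalues.{u} a b δ)
    fun l hl => LocalGlobal.eventually_le_secondEigenvalues hab hδ hl
  exact ⟨o, ho, fun V _ G hG hexp hconn =>
    hle _ _ ⟨V, inferInstance, G, rfl, hG, hexp, hconn, rfl⟩⟩
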